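/- Let $k$ be an algebraically closed field and let $\mathbf q=(q_{ij})\in M_n(k^\times)$ be multiplicatively antisymmetric, i.e. $q_{ii}=1$ and $q_{ji}=q_{ij}^{-1}$ for all $i,j$. Assume that $-1$ is not in the subgroup of $k^\times$ generated by the $q_{ij}$, or that $\operatorname{char}k=2$. Put $\Gamma=\mathbb Z^n$, $\Gamma^+=(\mathbb Z_{\ge 0})^n$, and $\sigma(\alpha,\beta)=\prod_{i,j}q_{ij}^{\alpha_i\beta_j}$ for $\alpha,\beta\in\Gamma$. Let $c:\Gamma\times\Gamma\to k^\times$ be an alternating bicharacter such that $c^2=\sigma$ and such that $c(\alpha,\beta)=1$ whenever $\sigma(\alpha,\beta)=1$. Let $A=\mathcal O_{\mathbf q}(k^n)=k\langle x_1,\dots,x_n\mid x_ix_j=q_{ij}x_jx_i \text{ for all } i,j\rangle$. Identify $A$ with the twisted semigroup algebra $k^c\Gamma^+$, which has a basis $(x_\alpha)_{\alpha\in\Gamma^+}$ with $x_\alpha x_\beta=c(\alpha,\beta)x_{\alpha+\beta}$, by letting $x_i$ correspond to $x_{\epsilon_i}$, where $\epsilon_1,\dots,\epsilon_n$ is the standard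 basis of $\Gamma$. Let $k\Gamma^+=k[y_1,\dots,y_n]$ be the commutative polynomial ring, with basis the monomials $y_\alpha$, and let $\Phi:A\to k\Gamma^+$ be the $k$-linear isomorphism with $\Phi(x_\alpha)=y_\alpha$ for all $\alpha\in\Gamma^+$. The torus $H=(k^\times)^n=\operatorname{Hom}(\Gamma,k^\times)$ acts on $k\Gamma^+$ by $h.y_\alpha=h(\alpha)y_\alpha$, where $h(\alpha)=\prod_i h_i^{\alpha_i}$. For $w\subseteq\{1,\dots,n\}$ let $\Gamma_w=\{\alpha\in\Gamma\mid \alpha_i=0\text{ for } i\in w\}$, let $\sigma_w$ be the restriction of $\sigma$ to $\Gamma_w$, let $\operatorname{rad}(\sigma_w)=\{\alpha\in\Gamma_w\mid\sigma(\alpha,\beta)=1\text{ for all }\beta\in\Gamma_w\}$, and let $\operatorname{rad}(\sigma_w)^\perp=\{h\in H\mid h(\alpha)=1\text{ for all }\alpha\in\operatorname{rad}(\sigma_w)\}$. Let $\operatorname{spec}_w k\Gamma^+$ be the set of those primes $P$ of $k\Gamma^+$ for which $y_i\in P\iff i\in w$; these sets partition $\operatorname{spec}k\Gamma^+$. For an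 ideal $P$ of $k\Gamma^+$ and $T\subseteq H$ put $(P:T)=\bigcap_{t\in T}t(P)$. Then the rule $$\phi(P)=\Phi^{-1}\bigl(P:\operatorname{rad}(\sigma_w)^\perp\bigr)\qquad\text{for } P\in\operatorname{spec}_w k\Gamma^+,\ w\subseteq\{1,\dots,n\},$$ defines a map $\phi:\operatorname{spec}k\Gamma^+\to\operatorname{spec}A$ into the set of prime two-sided ideals of $A$, and for every $P\in\operatorname{spec}k\Gamma^+$ the prime ideal $\phi(P)$ is the largest two-sided ideal of $A$ contained in the set $\Phi^{-1}(P)$. -/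

import Mathlib

namespace QuantumAffine

noncomputable section

/-! ### Bicharacters on `Γ = ℤⁿ` -/

/-- The matrix `q` with nonzero entries is multiplicatively antisymmetric. -/
def MulAntisymm {k : Type*} [Field k] {n : ℕ} (q : Matrix (Fin n) (Fin n) kˣ) : Prop :=
  (∀ i, q i i = 1) ∧ ∀ i j, q j i = (q i j)⁻¹

/-- `σ(α, β) = ∏ q_{ij} ^ (α_i β_j)`. -/
def sigma {k : Type*} [Field k] {n : ℕ} (q : Matrix (Fin n) (Fin n) kˣ)
    (α β : Fin n → ℤ) : kˣ :=
  ∏ i, ∏ j, q i j ^ (α i * β j)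

/-- Alternating bicharacters `c : ℤⁿ × ℤⁿ → kˣ`. -/
structure AltBichar (k : Type*) [Field k] (n : ℕ) where
  toFun : (Fin n → ℤ) → (Fin n → ℤ) → kˣ
  map_add_left : ∀ α α' β, toFun (α + α') β = toFun α β * toFun α' β
  map_add_right : ∀ α β β', toFun α (β + β') = toFun α β * toFun α β'
  map_self : ∀ α, toFun α α = 1

instance {k : Type*} [Field k] {n : ℕ} :
    CoeFun (AltBichar k n) (fun _ => (Fin n → ℤ) → (Fin n → ℤ) → kˣ) :=
  ⟨AltBichar.toFun⟩

/-- The inclusion of `Γ⁺ = (ℤ⁺)ⁿ` into `Γ = ℤⁿ`. -/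
def toInt {n : ℕ} (α : Fin n →₀ ℕ) : Fin n → ℤ := fun i => (α i : ℤ)

/-! ### Quantum affine space by generators and relations -/

/-- The relations `x_i x_j = q_{ij} x_j x_i`. -/
inductive QRel {k : Type*} [Field k] {n : ℕ} (q : Matrix (Fin n) (Fin n) kˣ) :
    FreeAlgebra k (Fin n) → FreeAlgebra k (Fin n) → Prop
  | comm (i j : Fin n) :
      QRel q (FreeAlgebra.ι k i * FreeAlgebra.ι k j)
        ((q i j : k) • (FreeAlgebra.ι k j * FreeAlgebra.ι k i))

/-- Quantum affine space `O_q(kⁿ) = k⟨x_1, …, x_n | x_i x_j = q_{ij} x_j x_i⟩`. -/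
abbrev QSpace {k : Type*} [Field k] {n : ℕ} (q : Matrix (Fin n) (Fin n) kˣ) : Type _ :=
  RingQuot (QRel q)

/-- The generator `x_i` of `O_q(kⁿ)`. -/
def QSpace.x {k : Type*} [Field k] {n : ℕ} (q : Matrix (Fin n) (Fin n) kˣ) (i : Fin n) :
    QSpace q :=
  RingQuot.mkAlgHom k (QRel q) (FreeAlgebra.ι k i)

/-! ### The twisted semigroup algebra `k^c Γ⁺` -/

namespace AltBichar

variable {k : Type*} [Field k] {n : ℕ} (c : AltBichar k n)

theorem zero_left (β : Fin n → ℤ) : c 0 β = 1 := by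
  have h := c.map_add_left 0 0 β
  rw [add_zero] at h
  exact left_eq_mul.mp h

theorem zero_right (α : Fin n → ℤ) : c α 0 = 1 := by
  have h := c.map_add_right α 0 0
  rw [add_zero] at h
  exact left_eq_mul.mp h

theorem mul_swap (α β : Fin n → ℤ) : c α β * c β α = 1 := by
  have h := c.map_self (α + β)
  rw [c.map_add_left, c.map_add_right, c.map_add_right, c.map_self, c.map_self] at h
  simpa using h

end AltBichar

theorem toInt_add {n : ℕ} (α β : Fin n →₀ ℕ) : toInt (α + β) = toInt α + toInt β := by
  funext i; simp [toInt]

theorem toInt_zero {n : ℕ} : toInt (0 : Fin n →₀ ℕ) = 0 := by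
  funext i; simp [toInt]

/-- The underlying space of `k^c Γ⁺`, with basis `x_α` (`α ∈ Γ⁺`). -/
def TwistedAlg {k : Type*} [Field k] {n : ℕ} (_c : AltBichar k n) : Type _ :=
  (Fin n →₀ ℕ) →₀ k

namespace TwistedAlg

variable {k : Type*} [Field k] {n : ℕ} (c : AltBichar k n)

instance : AddCommGroup (TwistedAlg c) :=
  inferInstanceAs (AddCommGroup ((Fin n →₀ ℕ) →₀ k))

instance : Module k (TwistedAlg c) :=
  inferInstanceAs (Module k ((Fin n →₀ ℕ) →₀ k))

/-- The basis `(x_α)` of `k^c Γ⁺`. -/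
def basis : Module.Basis (Fin n →₀ ℕ) k (TwistedAlg c) :=
  Module.Basis.ofRepr (LinearEquiv.refl k ((Fin n →₀ ℕ) →₀ k))

/-- The bilinear multiplication with `x_α x_β = c(α, β) x_{α + β}`. -/
def mulHom : TwistedAlg c →ₗ[k] TwistedAlg c →ₗ[k] TwistedAlg c :=
  (basis c).constr k fun α => (basis c).constr k fun β =>
    (c (toInt α) (toInt β) : k) • basis c (α + β)

theorem mulHom_basis (α β : Fin n →₀ ℕ) :
    mulHom c (basis c α) (basis c β) = (c (toInt α) (toInt β) : k) • basis c (α + β) := by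
  simp only [mulHom, Module.Basis.constr_basis]

theorem mulHom_assoc (a b d : TwistedAlg c) :
    mulHom c (mulHom c a b) d = mulHom c a (mulHom c b d) := by
  have h1 : ∀ α β, mulHom c (mulHom c (basis c α) (basis c β))
      = mulHom c (basis c α) ∘ₗ mulHom c (basis c β) := fun α β =>
    (basis c).ext fun γ => by
      simp only [LinearMap.comp_apply, mulHom_basis, map_smul, LinearMap.smul_apply,
        smul_smul, toInt_add, c.map_add_left, c.map_add_right, Units.val_mul, add_assoc]
      congr 1
      ring
  have h2 : ∀ α, mulHom c ∘ₗ mulHom c (basis c α)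
      = LinearMap.llcomp k _ _ _ (mulHom c (basis c α)) ∘ₗ mulHom c := fun α =>
    (basis c).ext fun β => h1 α β
  have h3 : mulHom c ∘ₗ (mulHom c).flip b
      = LinearMap.lcomp k _ (mulHom c b) ∘ₗ mulHom c :=
    (basis c).ext fun α => LinearMap.congr_fun (h2 α) b
  exact LinearMap.congr_fun (LinearMap.congr_fun h3 a) d

theorem one_mulHom (a : TwistedAlg c) : mulHom c (basis c 0) a = a := by
  have h : mulHom c (basis c 0) = LinearMap.id := (basis c).ext fun β => by
    simp [mulHom_basis, toInt_zero, c.zero_left]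
  rw [h, LinearMap.id_apply]

theorem mulHom_one (a : TwistedAlg c) : mulHom c a (basis c 0) = a := by
  have h : (mulHom c).flip (basis c 0) = LinearMap.id := (basis c).ext fun β => by
    simp [mulHom_basis, toInt_zero, c.zero_right]
  rw [← LinearMap.flip_apply, h, LinearMap.id_apply]

instance : Ring (TwistedAlg c) where
  __ := (inferInstance : AddCommGroup (TwistedAlg c))
  mul a b := mulHom c a b
  one := basis c 0
  mul_assoc := mulHom_assoc c
  one_mul := one_mulHom c
  mul_one := mulHom_one c
  left_distrib a b d := (mulHom c a).map_add b d
  right_distrib a b d := LinearMap.map_add₂ (mulHom c) a b d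
  zero_mul a := LinearMap.map_zero₂ (mulHom c) a
  mul_zero a := (mulHom c a).map_zero

instance : Algebra k (TwistedAlg c) :=
  Algebra.ofModule (fun r a b => LinearMap.map_smul₂ (mulHom c) r a b)
    (fun r a b => (mulHom c a).map_smul r b)

theorem basis_mul_basis (α β : Fin n →₀ ℕ) :
    basis c α * basis c β = (c (toInt α) (toInt β) : k) • basis c (α + β) :=
  mulHom_basis c α β

theorem one_def : (1 : TwistedAlg c) = basis c 0 := rfl

end TwistedAlg

/-! ### The identification of `O_q(kⁿ)` with `k^c Γ⁺` -/

section Identification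

variable {k : Type*} [Field k] {n : ℕ} {q : Matrix (Fin n) (Fin n) kˣ} {c : AltBichar k n}

theorem toInt_single (i : Fin n) :
    toInt (Finsupp.single i 1) = Pi.single i 1 := by
  funext j
  simp [toInt, Finsupp.single_apply, Pi.single_apply, eq_comm]

theorem sigma_single (q : Matrix (Fin n) (Fin n) kˣ) (i j : Fin n) :
    sigma q (Pi.single i 1) (Pi.single j 1) = q i j := by
  unfold sigma
  rw [Finset.prod_eq_single i, Finset.prod_eq_single j]
  · simp
  · intro b _ hb; simp [hb]
  · simp
  · intro b _ hb; simp [hb]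
  · simp

/-- The algebra homomorphism `O_q(kⁿ) → k^c Γ⁺` sending `x_i` to `x_{ε_i}`. -/
def toTwisted (hc : ∀ α β, c α β ^ 2 = sigma q α β) : QSpace q →ₐ[k] TwistedAlg c :=
  RingQuot.liftAlgHom k
    ⟨FreeAlgebra.lift k fun i => TwistedAlg.basis c (Finsupp.single i 1), by
      rintro _ _ ⟨i, j⟩
      have h1 := hc (toInt (Finsupp.single i 1)) (toInt (Finsupp.single j 1))
      have h2 := c.mul_swap (toInt (Finsupp.single i 1)) (toInt (Finsupp.single j 1))
      rw [toInt_single, toInt_single, sigma_single] at h1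
      rw [toInt_single, toInt_single] at h2
      simp only [map_mul, map_smul, FreeAlgebra.lift_ι_apply, TwistedAlg.basis_mul_basis,
        smul_smul, toInt_single, add_comm (Finsupp.single j 1) (Finsupp.single i 1)]
      congr 1
      rw [← Units.val_mul, ← h1, sq, mul_assoc, h2, mul_one]⟩

theorem toTwisted_x (hc : ∀ α β, c α β ^ 2 = sigma q α β) (i : Fin n) :
    toTwisted hc (QSpace.x q i) = TwistedAlg.basis c (Finsupp.single i 1) := by
  simp [toTwisted, QSpace.x]

theorem QSpace.x_mul_x (i j : Fin n) :
    QSpace.x q i * QSpace.x q j = (q i j : k) • (QSpace.x q j * QSpace.x q i) := by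
  have h := RingQuot.mkAlgHom_rel k (QRel.comm (q := q) i j)
  simpa [QSpace.x] using h

/-- The ordered monomial `x_1^{α_1} ⋯ x_n^{α_n}` in `O_q(kⁿ)`. -/
def orderedMonomial (q : Matrix (Fin n) (Fin n) kˣ) (α : Fin n →₀ ℕ) : QSpace q :=
  ((List.finRange n).map fun i => QSpace.x q i ^ α i).prod

theorem x_mul_x_pow (i j : Fin n) (a : ℕ) :
    ∃ u : kˣ, QSpace.x q i * QSpace.x q j ^ a
      = (u : k) • (QSpace.x q j ^ a * QSpace.x q i) := by
  induction a with
  | zero => exact ⟨1, by simp⟩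
  | succ a ih =>
    obtain ⟨u, hu⟩ := ih
    refine ⟨u * q i j, ?_⟩
    rw [pow_succ, ← mul_assoc, hu, smul_mul_assoc, mul_assoc, QSpace.x_mul_x i j,
      mul_smul_comm, smul_smul, Units.val_mul, mul_assoc]

theorem x_mul_list_prod (i : Fin n) (α : Fin n →₀ ℕ) (l : List (Fin n)) (hl : l.Nodup)
    (hi : i ∈ l) :
    ∃ u : kˣ, QSpace.x q i * (l.map fun j => QSpace.x q j ^ α j).prod
      = (u : k) • (l.map fun j => QSpace.x q j ^ (α + Finsupp.single i 1 : Fin n →₀ ℕ) j).prod := by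
  induction l with
  | nil => simp at hi
  | cons j l ih =>
    rw [List.nodup_cons] at hl
    simp only [List.map_cons, List.prod_cons]
    by_cases hij : i = j
    · subst hij
      refine ⟨1, ?_⟩
      have h : (l.map fun j => QSpace.x q j ^ (α + Finsupp.single i 1 : Fin n →₀ ℕ) j)
          = l.map fun j => QSpace.x q j ^ α j := by
        refine List.map_congr_left fun j hj => ?_
        have hne : i ≠ j := fun h => hl.1 (h ▸ hj)
        simp [hne]
      rw [h]
      simp only [Finsupp.add_apply, Finsupp.single_eq_same, Units.val_one, one_smul, pow_succ']
      rw [mul_assoc]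
    · obtain ⟨u, hu⟩ := x_mul_x_pow (q := q) i j (α j)
      obtain ⟨v, hv⟩ := ih hl.2 (by simpa [hij] using hi)
      refine ⟨u * v, ?_⟩
      rw [← mul_assoc, hu, smul_mul_assoc, mul_assoc, hv, mul_smul_comm, smul_smul,
        Units.val_mul]
      simp [Finsupp.single_apply, hij]

theorem x_mul_orderedMonomial (i : Fin n) (α : Fin n →₀ ℕ) :
    ∃ u : kˣ, QSpace.x q i * orderedMonomial q α
      = (u : k) • orderedMonomial q (α + Finsupp.single i 1) :=
  x_mul_list_prod i α _ (List.nodup_finRange n) (List.mem_finRange i)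

theorem orderedMonomial_zero : orderedMonomial q 0 = 1 := by
  simp [orderedMonomial]

theorem toTwisted_orderedMonomial (hc : ∀ α β, c α β ^ 2 = sigma q α β) (α : Fin n →₀ ℕ) :
    ∃ u : kˣ, toTwisted hc (orderedMonomial q α) = (u : k) • TwistedAlg.basis c α := by
  suffices h : ∀ β, (∃ u : kˣ, toTwisted hc (orderedMonomial q β)
      = (u : k) • TwistedAlg.basis c β) →
      ∃ u : kˣ, toTwisted hc (orderedMonomial q (β + α))
        = (u : k) • TwistedAlg.basis c (β + α) by
    have h0 := h 0 ⟨1, by simp [orderedMonomial_zero, TwistedAlg.one_def]⟩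
    rwa [zero_add] at h0
  induction α using Finsupp.induction_linear with
  | zero => intro β hβ; simpa using hβ
  | add f g hf hg =>
    intro β hβ
    rw [← add_assoc]
    exact hg _ (hf _ hβ)
  | single i a =>
    induction a with
    | zero => intro β hβ; simpa using hβ
    | succ a ih =>
      intro β hβ
      obtain ⟨u, hu⟩ := ih β hβ
      rw [Finsupp.single_add, ← add_assoc]
      set γ := β + Finsupp.single i a
      obtain ⟨v, hv⟩ := x_mul_orderedMonomial (q := q) i γ
      have hw := congrArg (toTwisted hc) hv
      rw [map_mul, toTwisted_x, hu, map_smul, mul_smul_comm, TwistedAlg.basis_mul_basis,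
        smul_smul, add_comm (Finsupp.single i 1) γ] at hw
      refine ⟨v⁻¹ * (u * c (toInt (Finsupp.single i 1)) (toInt γ)), ?_⟩
      rw [Units.val_mul, Units.val_mul, mul_smul, hw, smul_smul, Units.inv_mul, one_smul]

theorem span_orderedMonomial :
    Submodule.span k (Set.range (orderedMonomial q)) = ⊤ := by
  rw [eq_top_iff]
  intro a _
  suffices h : ∀ f : FreeAlgebra k (Fin n), ∀ s ∈ Submodule.span k (Set.range (orderedMonomial q)),
      RingQuot.mkAlgHom k (QRel q) f * s ∈ Submodule.span k (Set.range (orderedMonomial q)) by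
    obtain ⟨f, rfl⟩ := RingQuot.mkAlgHom_surjective k (QRel q) a
    have h1 := h f 1 (Submodule.subset_span ⟨0, orderedMonomial_zero⟩)
    rwa [mul_one] at h1
  intro f
  induction f using FreeAlgebra.induction with
  | grade0 r =>
    intro s hs
    rw [AlgHom.commutes, ← Algebra.smul_def]
    exact Submodule.smul_mem _ _ hs
  | grade1 i =>
    intro s hs
    induction hs using Submodule.span_induction with
    | mem _ h =>
      obtain ⟨α, rfl⟩ := h
      obtain ⟨u, hu⟩ := x_mul_orderedMonomial (q := q) i α
      change QSpace.x q i * _ ∈ _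
      rw [hu]
      exact Submodule.smul_mem _ _ (Submodule.subset_span ⟨_, rfl⟩)
    | zero => simp
    | add a b _ _ ha hb => rw [mul_add]; exact Submodule.add_mem _ ha hb
    | smul r a _ ha => rw [mul_smul_comm]; exact Submodule.smul_mem _ _ ha
  | mul f g hf hg =>
    intro s hs
    rw [map_mul, mul_assoc]
    exact hf _ (hg _ hs)
  | add f g hf hg =>
    intro s hs
    rw [map_add, add_mul]
    exact Submodule.add_mem _ (hf _ hs) (hg _ hs)

theorem toTwisted_bijective (hc : ∀ α β, c α β ^ 2 = sigma q α β) :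
    Function.Bijective (toTwisted hc) := by
  choose u hu using toTwisted_orderedMonomial (q := q) hc
  constructor
  · rw [injective_iff_map_eq_zero]
    intro a ha
    have hs : a ∈ Submodule.span k (Set.range (orderedMonomial q)) := by
      rw [span_orderedMonomial]; trivial
    obtain ⟨v, rfl⟩ := Finsupp.mem_span_range_iff_exists_finsupp.mp hs
    have hli := (TwistedAlg.basis c).linearIndependent.units_smul u
    rw [linearIndependent_iff] at hli
    have hv : v = 0 := hli v (by
      rw [Finsupp.linearCombination_apply]
      rw [Finsupp.sum, map_sum] at ha
      simp only [map_smul, hu] at ha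
      refine Eq.trans ?_ ha
      simp only [Finsupp.sum, Pi.smul_apply', Units.smul_def])
    simp [hv]
  · intro b
    rw [← AlgHom.mem_range]
    have hb : b ∈ Submodule.span k (Set.range (TwistedAlg.basis c)) := by
      rw [(TwistedAlg.basis c).span_eq]; trivial
    suffices h : Submodule.span k (Set.range (TwistedAlg.basis c))
        ≤ Subalgebra.toSubmodule (toTwisted hc).range from h hb
    rw [Submodule.span_le]
    rintro _ ⟨α, rfl⟩
    refine ⟨((u α)⁻¹ : kˣ) • orderedMonomial q α, ?_⟩
    change toTwisted hc (((u α)⁻¹ : kˣ) • orderedMonomial q α) = _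
    rw [Units.smul_def, map_smul, hu, smul_smul, Units.inv_mul, one_smul]

/-- The identification of `O_q(kⁿ)` with `k^c Γ⁺`, under which `x_i` becomes `x_{ε_i}`. -/
def equivTwisted (hc : ∀ α β, c α β ^ 2 = sigma q α β) : QSpace q ≃ₐ[k] TwistedAlg c :=
  AlgEquiv.ofBijective (toTwisted hc) (toTwisted_bijective hc)

/-- The `k`-linear isomorphism `Φ : O_q(kⁿ) = k^c Γ⁺ → k Γ⁺ = k[y_1, …, y_n]` with
`Φ(x_α) = y_α` for all `α ∈ Γ⁺`. -/
def twist (hc : ∀ α β, c α β ^ 2 = sigma q α β) : QSpace q ≃ₗ[k] MvPolynomial (Fin n) k :=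
  (equivTwisted hc).toLinearEquiv ≪≫ₗ
    (TwistedAlg.basis c).equiv (MvPolynomial.basisMonomials (Fin n) k) (Equiv.refl _)

end Identification

/-! ### The torus `H = (kˣ)ⁿ`, radicals and orthogonals -/

section Torus

variable {k : Type*} [Field k] {n : ℕ}

/-- The algebra endomorphism of `k[y_1, …, y_n]` with `y_i ↦ h_i y_i`. -/
def torusHom (h : Fin n → kˣ) : MvPolynomial (Fin n) k →ₐ[k] MvPolynomial (Fin n) k :=
  MvPolynomial.aeval fun i => (h i : k) • MvPolynomial.X i

theorem torusHom_comp (g h : Fin n → kˣ) (hgh : ∀ i, g i * h i = 1) :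
    (torusHom g).comp (torusHom h) = AlgHom.id k _ := by
  refine MvPolynomial.algHom_ext fun i => ?_
  simp only [torusHom, AlgHom.comp_apply, MvPolynomial.aeval_X, map_smul, smul_smul,
    AlgHom.id_apply]
  rw [← Units.val_mul, mul_comm, hgh, Units.val_one, one_smul]

/-- The automorphism of `k[y_1, …, y_n]` by which `h ∈ H` acts: `y_i ↦ h_i y_i`. -/
def torusAct (h : Fin n → kˣ) : MvPolynomial (Fin n) k ≃ₐ[k] MvPolynomial (Fin n) k :=
  AlgEquiv.ofAlgHom (torusHom h) (torusHom h⁻¹)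
    (torusHom_comp _ _ fun i => by simp) (torusHom_comp _ _ fun i => by simp)

/-- The pairing `H × Γ → kˣ`, `h(α) = ∏ h_i ^ α_i`. -/
def pairing (h : Fin n → kˣ) (α : Fin n → ℤ) : kˣ := ∏ i, h i ^ α i

/-- `S^⊥ = {h ∈ H | h(α) = 1 for all α ∈ S}`. -/
def perp (S : Set (Fin n → ℤ)) : Set (Fin n → kˣ) :=
  {h | ∀ α ∈ S, pairing h α = 1}

/-- `Γ_w = {α ∈ Γ | α_i = 0 for i ∈ w}`. -/
def gammaSub (w : Set (Fin n)) : Set (Fin n → ℤ) := {α | ∀ i ∈ w, α i = 0}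

/-- `rad(σ_w)`, the radical of the restriction `σ_w` of `σ` to `Γ_w`. -/
def radical (q : Matrix (Fin n) (Fin n) kˣ) (w : Set (Fin n)) : Set (Fin n → ℤ) :=
  {α | α ∈ gammaSub w ∧ ∀ β ∈ gammaSub w, sigma q α β = 1}

/-- `(P : T) = ⋂_{t ∈ T} t(P)`. -/
def orbitInf (P : Ideal (MvPolynomial (Fin n) k)) (T : Set (Fin n → kˣ)) :
    Ideal (MvPolynomial (Fin n) k) :=
  ⨅ t ∈ T, P.map (torusAct t)

/-- The stratum `spec_w k[y_1, …, y_n]`: the primes `P` with `y_i ∈ P ↔ i ∈ w`. -/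
def specStratum (k : Type*) [Field k] {n : ℕ} (w : Set (Fin n)) :
    Set (PrimeSpectrum (MvPolynomial (Fin n) k)) :=
  {P | ∀ i, MvPolynomial.X i ∈ P.asIdeal ↔ i ∈ w}

end Torus

/-! ### Prime ideals of noncommutative rings -/

/-- A two-sided ideal `P` of a ring is prime: it is proper, and whenever it contains a product
`JK` of two-sided ideals, it contains `J` or `K`. -/
def IsPrimeTwoSided {A : Type*} [Ring A] (P : TwoSidedIdeal A) : Prop :=
  P ≠ ⊤ ∧ ∀ J K : TwoSidedIdeal A, (∀ a ∈ J, ∀ b ∈ K, a * b ∈ P) → J ≤ P ∨ K ≤ P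

/-- The set `spec A` of prime (two-sided) ideals of a ring `A`. -/
def NCSpec (A : Type*) [Ring A] : Type _ := {P : TwoSidedIdeal A // IsPrimeTwoSided P}

end

end QuantumAffine

namespace QuantumAffine

noncomputable section

open MvPolynomial

/-! ### Separation of characters -/

/-! Fix `P` in the stratum of `w`. Monomials with an exponent outside `Γ_w` lie in `P`, those with
exponent in `Γ_w` do not. The exponent `α` gives the character `c(α, -)` of `Γ_w ∩ Γ⁺`; group the
terms of `f` by this character. Then `f` lies in `(P : rad(σ_w)^⊥)` iff every component lies in `P`
(`mem_orbitInf_iff_comp`). For one direction, the points `c(-, γ)` with `γ ∈ Γ_w ∩ Γ⁺` lie in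
`rad(σ_w)^⊥`, and independence of characters recovers the components of `f` from its translates by
them. For the other, exponents in `Γ_w` with equal characters differ by an element of `rad(σ_w)`, so
`rad(σ_w)^⊥` acts on each component by scalars modulo `P`.

The noncommutative product enters through `Φ(a x_γ) = y_γ · (c(-, γ).Φ(a))` and its left-hand
analogue. Hence `Φ⁻¹(P : rad(σ_w)^⊥)` is a two-sided ideal. It is the largest one inside `Φ⁻¹(P)`:
if `J` is another and `a ∈ J`, then `Φ(a x_γ) ∈ P`, and cancelling `y_γ ∉ P` puts all these
translates of `Φ(a)` in `P`.

For primeness, let `Φ(x_γ' a x_γ b) ∈ P` for all `γ', γ`. As functions of `(γ', γ)`, the scalars in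
this expansion are characters that separate pairs of components of `Φ(a)` and `Φ(b)`
(`pairChar_eq_iff`). So every product of a component of `Φ(a)` with one of `Φ(b)` lies in the prime
`P`. -/

open Classical in
/-- Independence of characters: if a subspace contains all sums `∑ χ_i(m) v_i`, then it contains
the partial sum of the `v_i` over each fibre of `i ↦ χ_i`. -/
theorem sum_fiber_mem_of_forall_char {k V M ι : Type*} [Field k] [AddCommGroup V] [Module k V]
    [Monoid M] (N : Submodule k V) (s : Finset ι) (χ : ι → M →* k) (v : ι → V)
    (h : ∀ m, ∑ i ∈ s, χ i m • v i ∈ N) (ψ : M →* k) :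
    ∑ i ∈ s with χ i = ψ, v i ∈ N := by
  by_contra hψ
  -- A functional vanishing on `N` but not on the fibre sum over `ψ` turns the hypothesis into a
  -- linear relation among distinct characters.
  obtain ⟨f, hf, hN⟩ := Submodule.exists_le_ker_of_notMem hψ
  -- `ψ` is inserted because it need not be one of the `χ i`; its fibre is then empty.
  have hmap : ∀ i ∈ s, χ i ∈ insert ψ (s.image χ) := fun i hi =>
    Finset.mem_insert_of_mem (Finset.mem_image_of_mem χ hi)
  refine hf (linearIndependent_iff'.mp (linearIndependent_monoidHom M k) (insert ψ (s.image χ))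
    (fun ξ => f (∑ i ∈ s with χ i = ξ, v i)) ?_ ψ (Finset.mem_insert_self _ _))
  funext m
  have hm : f (∑ i ∈ s, χ i m • v i) = 0 := hN (h m)
  rw [← Finset.sum_fiberwise_of_maps_to hmap, map_sum] at hm
  rw [Finset.sum_apply, Pi.zero_apply, ← hm]
  refine Finset.sum_congr rfl fun ξ _ => ?_
  rw [Pi.smul_apply, smul_eq_mul, map_sum, map_sum, Finset.sum_mul]
  refine Finset.sum_congr rfl fun i hi => ?_
  rw [map_smul, smul_eq_mul, (Finset.mem_filter.mp hi).2, mul_comm]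

/-! ### Bicharacters and the torus -/

namespace AltBichar

variable {k : Type*} [Field k] {n : ℕ} (c : AltBichar k n)

theorem swap (α β : Fin n → ℤ) : c β α = (c α β)⁻¹ :=
  eq_inv_of_mul_eq_one_right (c.mul_swap α β)

theorem sub_left (α α' β : Fin n → ℤ) : c (α - α') β = c α β / c α' β := by
  rw [eq_div_iff_mul_eq', mul_comm, ← c.map_add_left, add_sub_cancel]

theorem sub_right (α β β' : Fin n → ℤ) : c α (β - β') = c α β / c α β' := by
  rw [eq_div_iff_mul_eq', mul_comm, ← c.map_add_right, add_sub_cancel]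

/-- The point `c(-, β)` of the torus. -/
def torusPoint (β : Fin n → ℤ) : Fin n → kˣ := fun i => c (Pi.single i 1) β

theorem pairing_torusPoint (α β : Fin n → ℤ) : pairing (c.torusPoint β) α = c α β := by
  let f : (Fin n → ℤ) →+ Additive kˣ :=
    AddMonoidHom.mk' (fun α => Additive.ofMul (c α β)) fun α α' => by
      rw [c.map_add_left, ofMul_mul]
  have h : f α = ∑ i, α i • f (Pi.single i 1) := by
    conv_lhs => rw [pi_eq_sum_univ' α]
    rw [map_sum]
    exact Finset.sum_congr rfl fun i _ => map_zsmul f _ _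
  exact (congrArg Additive.toMul h).symm

end AltBichar

section

variable {k : Type*} [Field k] {n : ℕ}

theorem pairing_sub (h : Fin n → kˣ) (α β : Fin n → ℤ) :
    pairing h (α - β) = pairing h α / pairing h β := by
  simp [pairing, zpow_sub, Finset.prod_mul_distrib, div_eq_mul_inv]

theorem pairing_mul (g h : Fin n → kˣ) (α : Fin n → ℤ) :
    pairing (g * h) α = pairing g α * pairing h α := by
  simp [pairing, mul_zpow, Finset.prod_mul_distrib]

theorem pairing_inv (h : Fin n → kˣ) (α : Fin n → ℤ) :
    pairing h⁻¹ α = (pairing h α)⁻¹ := by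
  simp [pairing]

theorem perp_mul_mem {S : Set (Fin n → ℤ)} {g h : Fin n → kˣ} (hg : g ∈ perp S)
    (hh : h ∈ perp S) : g * h ∈ perp S := fun α hα => by
  rw [pairing_mul, hg α hα, hh α hα, one_mul]

theorem perp_inv_mem {S : Set (Fin n → ℤ)} {h : Fin n → kˣ} (hh : h ∈ perp S) :
    h⁻¹ ∈ perp S := fun α hα => by
  rw [pairing_inv, hh α hα, inv_one]

theorem one_mem_perp (S : Set (Fin n → ℤ)) : (1 : Fin n → kˣ) ∈ perp S := fun α _ => by
  simp [pairing]

theorem torusHom_monomial (h : Fin n → kˣ) (α : Fin n →₀ ℕ) (r : k) :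
    torusHom h (monomial α r) = (pairing h (toInt α) : k) • monomial α r := by
  rw [torusHom, aeval_monomial, monomial_eq, Finsupp.prod_fintype _ _ (by simp),
    Finsupp.prod_fintype _ _ (by simp), MvPolynomial.algebraMap_eq]
  simp only [smul_pow, Finset.prod_smul, mul_smul_comm]
  simp [pairing, toInt]

theorem torusHom_torusHom (g h : Fin n → kˣ) (f : MvPolynomial (Fin n) k) :
    torusHom g (torusHom h f) = torusHom (g * h) f := by
  induction f using MvPolynomial.induction_on' with
  | monomial α r =>
    rw [torusHom_monomial, map_smul, torusHom_monomial, torusHom_monomial, smul_smul, pairing_mul,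
      Units.val_mul, mul_comm]
  | add f g hf hg => rw [map_add, map_add, map_add, hf, hg]

theorem torusHom_eq_sum (h : Fin n → kˣ) (f : MvPolynomial (Fin n) k) :
    torusHom h f = ∑ α ∈ f.support, (pairing h (toInt α) : k) • monomial α (coeff α f) := by
  conv_lhs => rw [← support_sum_monomial_coeff f]
  rw [map_sum]
  exact Finset.sum_congr rfl fun α _ => torusHom_monomial h α _

theorem torusHom_one (f : MvPolynomial (Fin n) k) : torusHom 1 f = f := by
  rw [torusHom_eq_sum]
  simp [pairing]

/-- `S^⊥` is closed under inverses, so preimages under the action may replace the images `t(P)`. -/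
theorem mem_orbitInf_perp {P : Ideal (MvPolynomial (Fin n) k)} {S : Set (Fin n → ℤ)}
    {f : MvPolynomial (Fin n) k} :
    f ∈ orbitInf P (perp S) ↔ ∀ t ∈ perp S, torusHom t f ∈ P := by
  have key : ∀ t : Fin n → kˣ, f ∈ P.map (torusAct t) ↔ torusHom t⁻¹ f ∈ P := fun t => by
    rw [Ideal.mem_map_of_equiv]
    constructor
    · rintro ⟨g, hg, rfl⟩
      change torusHom t⁻¹ (torusHom t g) ∈ P
      rwa [torusHom_torusHom, inv_mul_cancel, torusHom_one]
    · intro h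
      refine ⟨_, h, ?_⟩
      change torusHom t (torusHom t⁻¹ f) = f
      rw [torusHom_torusHom, mul_inv_cancel, torusHom_one]
  simp only [orbitInf, Ideal.mem_iInf, key]
  exact ⟨fun h t ht => by simpa using h t⁻¹ (perp_inv_mem ht), fun h t ht => h _ (perp_inv_mem ht)⟩

/-! ### Components of polynomials with respect to `c(-, Γ_w)` -/

/-- The submonoid `Γ_w ∩ Γ⁺`. -/
def gammaPos (w : Set (Fin n)) : AddSubmonoid (Fin n →₀ ℕ) where
  carrier := {α | ∀ i ∈ w, α i = 0}
  zero_mem' := fun _ _ => rfl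
  add_mem' := fun ha hb i hi => by simp [ha i hi, hb i hi]

theorem toInt_mem_gammaSub {w : Set (Fin n)} {α : Fin n →₀ ℕ} (h : α ∈ gammaPos w) :
    toInt α ∈ gammaSub w := fun i hi => by simp [toInt, h i hi]

theorem exists_toInt_sub {w : Set (Fin n)} {β : Fin n → ℤ} (h : β ∈ gammaSub w) :
    ∃ γ ∈ gammaPos w, ∃ γ' ∈ gammaPos w, β = toInt γ - toInt γ' := by
  refine ⟨Finsupp.equivFunOnFinite.symm fun i => (β i).toNat, fun i hi => by simp [h i hi],
    Finsupp.equivFunOnFinite.symm fun i => (-β i).toNat, fun i hi => by simp [h i hi], ?_⟩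
  funext i
  simp [toInt]

/-- The character `c(α, -)` of `Γ_w ∩ Γ⁺`. -/
def charOf (c : AltBichar k n) (w : Set (Fin n)) (α : Fin n →₀ ℕ) :
    Multiplicative (gammaPos w) →* k where
  toFun γ := c (toInt α) (toInt (γ.toAdd : Fin n →₀ ℕ))
  map_one' := by simp [toInt_zero, c.zero_right]
  map_mul' := by simp [toInt_add, c.map_add_right]

theorem charOf_eq_iff {c : AltBichar k n} {w : Set (Fin n)} {α α' : Fin n →₀ ℕ} :
    charOf c w α = charOf c w α' ↔
      ∀ γ ∈ gammaPos w, c (toInt α) (toInt γ) = c (toInt α') (toInt γ) := by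
  rw [MonoidHom.ext_iff]
  constructor
  · intro h γ hγ
    exact Units.ext (h (Multiplicative.ofAdd ⟨γ, hγ⟩))
  · intro h γ
    exact congrArg Units.val (h _ γ.toAdd.2)

open Classical in
/-- The component of `f` belonging to the character `χ` of `Γ_w ∩ Γ⁺`. -/
def comp (c : AltBichar k n) (w : Set (Fin n)) (f : MvPolynomial (Fin n) k)
    (χ : Multiplicative (gammaPos w) →* k) : MvPolynomial (Fin n) k :=
  ∑ α ∈ f.support with charOf c w α = χ, monomial α (coeff α f)

theorem monomial_mem_of_notMem_gammaPos {w : Set (Fin n)} {P : Ideal (MvPolynomial (Fin n) k)}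
    (hP : ∀ i ∈ w, X i ∈ P) {α : Fin n →₀ ℕ} (hα : α ∉ gammaPos w) (r : k) :
    monomial α r ∈ P := by
  have : ∃ i ∈ w, α i ≠ 0 := by
    by_contra! h
    exact hα h
  obtain ⟨i, hi, hne⟩ := this
  have h : (monomial α r : MvPolynomial (Fin n) k)
      = monomial (α - Finsupp.single i 1) r * X i := by
    rw [X, monomial_mul, mul_one, tsub_add_cancel_of_le]
    rw [Finsupp.single_le_iff]
    omega
  rw [h]
  exact P.mul_mem_left _ (hP i hi)

theorem monomial_notMem_of_mem_gammaPos {w : Set (Fin n)} {P : Ideal (MvPolynomial (Fin n) k)}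
    [P.IsPrime] (hP : ∀ i, X i ∈ P → i ∈ w) {α : Fin n →₀ ℕ} (hα : α ∈ gammaPos w) :
    monomial α (1 : k) ∉ P := by
  rw [monomial_eq, C_1, one_mul, Finsupp.prod, Ideal.IsPrime.prod_mem_iff]
  rintro ⟨i, hi, h⟩
  exact (Finsupp.mem_support_iff.mp hi) (hα i (hP i (Ideal.IsPrime.mem_of_pow_mem ‹_› _ h)))

/-- `Γ_w ∩ Γ⁺` generates `Γ_w` as a group, so characters equal on it give equal values of `c` on all
of `Γ_w`; squaring passes to `σ`. -/
theorem sub_mem_radical {q : Matrix (Fin n) (Fin n) kˣ} {c : AltBichar k n}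
    (hc : ∀ α β, c α β ^ 2 = sigma q α β) {w : Set (Fin n)} {α α' : Fin n →₀ ℕ}
    (hα : α ∈ gammaPos w) (hα' : α' ∈ gammaPos w) (h : charOf c w α = charOf c w α') :
    toInt α - toInt α' ∈ radical q w := by
  rw [charOf_eq_iff] at h
  refine ⟨fun i hi => ?_, fun β hβ => ?_⟩
  · simp [toInt, hα i hi, hα' i hi]
  · obtain ⟨γ, hγ, γ', hγ', rfl⟩ := exists_toInt_sub hβ
    rw [← hc, c.sub_left, c.sub_right, c.sub_right, h γ hγ, h γ' hγ', div_self', one_pow]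

/-- This is where `σ = 1` must force `c = 1`: the radical is defined by `σ`, but the twisting is
done by `c`. -/
theorem torusPoint_mem_perp {q : Matrix (Fin n) (Fin n) kˣ} {c : AltBichar k n}
    (hc_one : ∀ α β, sigma q α β = 1 → c α β = 1) {w : Set (Fin n)} {γ : Fin n →₀ ℕ}
    (hγ : γ ∈ gammaPos w) : c.torusPoint (toInt γ) ∈ perp (radical q w) := fun α hα => by
  rw [c.pairing_torusPoint]
  exact hc_one _ _ (hα.2 _ (toInt_mem_gammaSub hγ))

/-- If `P` contains the translates of `f` by all `c(-, γ)`, then it contains the components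
of `f`. -/
theorem comp_mem_of_forall_torusHom_mem {c : AltBichar k n} {w : Set (Fin n)}
    {P : Ideal (MvPolynomial (Fin n) k)} {f : MvPolynomial (Fin n) k}
    (h : ∀ γ ∈ gammaPos w, torusHom (c.torusPoint (toInt γ)) f ∈ P)
    (χ : Multiplicative (gammaPos w) →* k) : comp c w f χ ∈ P := by
  refine sum_fiber_mem_of_forall_char (P.restrictScalars k) f.support (charOf c w)
    (fun α => monomial α (coeff α f)) (fun γ => ?_) χ
  have hγ := h _ γ.toAdd.2
  simp only [torusHom_eq_sum, c.pairing_torusPoint] at hγ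
  exact hγ

/-- Modulo `P` only exponents in `Γ_w` survive. Those of one component are congruent modulo
`rad(σ_w)`, so `t` multiplies the component by a single scalar. -/
theorem torusHom_mem_of_forall_comp_mem {q : Matrix (Fin n) (Fin n) kˣ} {c : AltBichar k n}
    (hc : ∀ α β, c α β ^ 2 = sigma q α β) {w : Set (Fin n)}
    {P : Ideal (MvPolynomial (Fin n) k)} (hP : ∀ i ∈ w, X i ∈ P) {f : MvPolynomial (Fin n) k}
    (h : ∀ χ, comp c w f χ ∈ P) {t : Fin n → kˣ} (ht : t ∈ perp (radical q w)) :
    torusHom t f ∈ P := by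
  classical
  rw [torusHom_eq_sum, ← Finset.sum_fiberwise_of_maps_to
    (fun i hi => Finset.mem_image_of_mem (charOf c w) hi)]
  refine sum_mem fun χ _ => ?_
  by_cases hα₀ : ∃ α₀ ∈ gammaPos w, charOf c w α₀ = χ
  · obtain ⟨α₀, hα₀, rfl⟩ := hα₀
    have h₀ : (pairing t (toInt α₀) : k) • comp c w f (charOf c w α₀) ∈ P :=
      Submodule.smul_of_tower_mem P _ (h _)
    rw [comp, Finset.smul_sum] at h₀
    -- Compare with the component scaled by `t(α₀)`: the difference vanishes termwise on `Γ_w`, and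
    -- its other terms are monomials in `P`.
    refine (Submodule.sub_mem_iff_left P h₀).mp ?_
    rw [← Finset.sum_sub_distrib]
    refine sum_mem fun α hα => ?_
    by_cases hαw : α ∈ gammaPos w
    · have := ht _ (sub_mem_radical hc hαw hα₀ (Finset.mem_filter.mp hα).2)
      rw [pairing_sub, div_eq_one] at this
      rw [this, sub_self]
      exact P.zero_mem
    · rw [← sub_smul]
      exact Submodule.smul_of_tower_mem P _ (monomial_mem_of_notMem_gammaPos hP hαw _)
  · refine sum_mem fun α hα => Submodule.smul_of_tower_mem P _
      (monomial_mem_of_notMem_gammaPos hP (fun hαw => hα₀ ⟨α, hαw, (Finset.mem_filter.mp hα).2⟩) _)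

theorem mem_orbitInf_iff_comp {q : Matrix (Fin n) (Fin n) kˣ} {c : AltBichar k n}
    (hc : ∀ α β, c α β ^ 2 = sigma q α β) (hc_one : ∀ α β, sigma q α β = 1 → c α β = 1)
    {w : Set (Fin n)} {P : Ideal (MvPolynomial (Fin n) k)} (hP : ∀ i ∈ w, X i ∈ P)
    {f : MvPolynomial (Fin n) k} :
    f ∈ orbitInf P (perp (radical q w)) ↔ ∀ χ, comp c w f χ ∈ P := by
  rw [mem_orbitInf_perp]
  exact ⟨fun h => comp_mem_of_forall_torusHom_mem fun γ hγ => h _ (torusPoint_mem_perp hc_one hγ),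
    fun h t ht => torusHom_mem_of_forall_comp_mem hc hP h ht⟩

end

section

variable {k : Type*} [Field k] {n : ℕ} {q : Matrix (Fin n) (Fin n) kˣ} {c : AltBichar k n}

/-! ### Multiplication of `O_q(kⁿ)` in terms of the basis `x_α` -/

/-- The element `x_α` of `O_q(kⁿ)`. -/
def xBasis (hc : ∀ α β, c α β ^ 2 = sigma q α β) (α : Fin n →₀ ℕ) : QSpace q :=
  (twist hc).symm (monomial α 1)

variable (hc : ∀ α β, c α β ^ 2 = sigma q α β)

theorem twist_xBasis (α : Fin n →₀ ℕ) : twist hc (xBasis hc α) = monomial α 1 :=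
  (twist hc).apply_symm_apply _

theorem equivTwisted_xBasis (α : Fin n →₀ ℕ) :
    equivTwisted hc (xBasis hc α) = TwistedAlg.basis c α := by
  have h : twist hc ((equivTwisted hc).symm (TwistedAlg.basis c α)) = monomial α 1 := by
    simp [twist, Module.Basis.equiv_apply, coe_basisMonomials]
  rw [xBasis, ← h, LinearEquiv.symm_apply_apply, AlgEquiv.apply_symm_apply]

theorem xBasis_mul_xBasis (α β : Fin n →₀ ℕ) :
    xBasis hc α * xBasis hc β = (c (toInt α) (toInt β) : k) • xBasis hc (α + β) := by
  apply (equivTwisted hc).injective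
  rw [map_mul, map_smul, equivTwisted_xBasis, equivTwisted_xBasis, equivTwisted_xBasis,
    TwistedAlg.basis_mul_basis]

theorem sum_coeff_smul_xBasis (a : QSpace q) :
    ∑ α ∈ (twist hc a).support, coeff α (twist hc a) • xBasis hc α = a := by
  apply (twist hc).injective
  conv_rhs => rw [← support_sum_monomial_coeff (twist hc a)]
  rw [map_sum]
  refine Finset.sum_congr rfl fun α _ => ?_
  rw [map_smul, twist_xBasis, smul_monomial, smul_eq_mul, mul_one]

/-- Right multiplication by `x_γ` scales the term at `α` by `c(α, γ)`, which is the action of the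
torus point `c(-, γ)`, and shifts exponents by `γ`. -/
theorem twist_mul_xBasis (a : QSpace q) (γ : Fin n →₀ ℕ) :
    twist hc (a * xBasis hc γ)
      = monomial γ 1 * torusHom (c.torusPoint (toInt γ)) (twist hc a) := by
  rw [torusHom_eq_sum]
  conv_lhs => rw [← sum_coeff_smul_xBasis hc a]
  rw [Finset.sum_mul, map_sum, Finset.mul_sum]
  refine Finset.sum_congr rfl fun α _ => ?_
  rw [smul_mul_assoc, xBasis_mul_xBasis, map_smul, map_smul, twist_xBasis, c.pairing_torusPoint,
    mul_smul_comm, monomial_mul, smul_monomial, smul_monomial, smul_monomial, add_comm γ α]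
  simp only [smul_eq_mul]
  congr 1
  ring

theorem twist_xBasis_mul (a : QSpace q) (γ : Fin n →₀ ℕ) :
    twist hc (xBasis hc γ * a)
      = monomial γ 1 * torusHom (c.torusPoint (toInt γ))⁻¹ (twist hc a) := by
  rw [torusHom_eq_sum]
  conv_lhs => rw [← sum_coeff_smul_xBasis hc a]
  rw [Finset.mul_sum, map_sum, Finset.mul_sum]
  refine Finset.sum_congr rfl fun α _ => ?_
  rw [mul_smul_comm, xBasis_mul_xBasis, map_smul, map_smul, twist_xBasis, pairing_inv,
    c.pairing_torusPoint, mul_smul_comm, monomial_mul, smul_monomial, smul_monomial, smul_monomial,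
    c.swap (toInt α) (toInt γ)]
  simp only [smul_eq_mul]
  congr 1
  ring

/-! ### The two-sided ideal `Φ⁻¹(P : rad(σ_w)^⊥)` -/

/-- For `γ ∈ Γ_w` the translation by `s` is absorbed by the group `rad(σ_w)^⊥`; otherwise every
translate of `y_γ` already lies in `P`, and `s` is arbitrary. -/
theorem monomial_mul_torusHom_mem_orbitInf {w : Set (Fin n)} {P : Ideal (MvPolynomial (Fin n) k)}
    (hP : ∀ i ∈ w, X i ∈ P) {f : MvPolynomial (Fin n) k}
    (hf : f ∈ orbitInf P (perp (radical q w))) (γ : Fin n →₀ ℕ) {s : Fin n → kˣ}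
    (hs : γ ∈ gammaPos w → s ∈ perp (radical q w)) :
    monomial γ 1 * torusHom s f ∈ orbitInf P (perp (radical q w)) := by
  rw [mem_orbitInf_perp] at hf ⊢
  intro t ht
  rw [map_mul, torusHom_torusHom, torusHom_monomial]
  by_cases hγ : γ ∈ gammaPos w
  · exact P.mul_mem_left _ (hf _ (perp_mul_mem ht (hs hγ)))
  · exact P.mul_mem_right _
      (Submodule.smul_of_tower_mem P _ (monomial_mem_of_notMem_gammaPos hP hγ _))

/-- The two-sided ideal `Φ⁻¹(P : rad(σ_w)^⊥)` of `O_q(kⁿ)`. -/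
def twistedIdeal (hc_one : ∀ α β, sigma q α β = 1 → c α β = 1) (w : Set (Fin n))
    (P : Ideal (MvPolynomial (Fin n) k)) (hP : ∀ i ∈ w, X i ∈ P) : TwoSidedIdeal (QSpace q) :=
  TwoSidedIdeal.mk' {a | twist hc a ∈ orbitInf P (perp (radical q w))}
    (by simp)
    (fun ha hb => by
      rw [Set.mem_ofPred_eq, map_add]
      exact add_mem ha hb)
    (fun ha => by
      rw [Set.mem_ofPred_eq, map_neg]
      exact neg_mem ha)
    (fun {a b} hb => by
      rw [Set.mem_ofPred_eq, ← sum_coeff_smul_xBasis hc a, Finset.sum_mul, map_sum]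
      refine sum_mem fun γ _ => ?_
      rw [smul_mul_assoc, map_smul, twist_xBasis_mul]
      exact Submodule.smul_of_tower_mem _ _ (monomial_mul_torusHom_mem_orbitInf hP hb γ
        fun hγ => perp_inv_mem (torusPoint_mem_perp hc_one hγ)))
    (fun {b a} hb => by
      rw [Set.mem_ofPred_eq, ← sum_coeff_smul_xBasis hc a, Finset.mul_sum, map_sum]
      refine sum_mem fun γ _ => ?_
      rw [mul_smul_comm, map_smul, twist_mul_xBasis]
      exact Submodule.smul_of_tower_mem _ _ (monomial_mul_torusHom_mem_orbitInf hP hb γ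
        fun hγ => torusPoint_mem_perp hc_one hγ))

theorem mem_twistedIdeal {hc_one : ∀ α β, sigma q α β = 1 → c α β = 1} {w : Set (Fin n)}
    {P : Ideal (MvPolynomial (Fin n) k)} {hP : ∀ i ∈ w, X i ∈ P} {a : QSpace q} :
    a ∈ twistedIdeal hc hc_one w P hP ↔ twist hc a ∈ orbitInf P (perp (radical q w)) :=
  TwoSidedIdeal.mem_mk' _ _ _ _ _ _ _

theorem isGreatest_twistedIdeal (hc_one : ∀ α β, sigma q α β = 1 → c α β = 1) {w : Set (Fin n)}
    {P : Ideal (MvPolynomial (Fin n) k)} [P.IsPrime] (hP : ∀ i, X i ∈ P ↔ i ∈ w) :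
    IsGreatest
      {I : TwoSidedIdeal (QSpace q) |
        (I : Set (QSpace q)) ⊆ twist hc ⁻¹' (P : Set (MvPolynomial (Fin n) k))}
      (twistedIdeal hc hc_one w P fun i => (hP i).mpr) := by
  constructor
  · intro a ha
    have h := mem_orbitInf_perp.mp ((mem_twistedIdeal hc).mp ha) 1 (one_mem_perp _)
    rwa [torusHom_one] at h
  · intro J hJ a ha
    rw [mem_twistedIdeal, mem_orbitInf_iff_comp hc hc_one fun i => (hP i).mpr]
    refine comp_mem_of_forall_torusHom_mem fun γ hγ => ?_
    have h : twist hc (a * xBasis hc γ) ∈ P := hJ (J.mul_mem_right _ _ ha)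
    rw [twist_mul_xBasis] at h
    exact (Ideal.IsPrime.mem_or_mem ‹_› h).resolve_left
      (monomial_notMem_of_mem_gammaPos (fun i => (hP i).mp) hγ)

/-! ### Primeness -/

/-- The character `(γ', γ) ↦ c(γ', α) c(α, γ) c(γ', β) c(γ, β)`, by which the terms of a product
`x_{γ'} a x_γ b` are scaled. -/
def pairChar (c : AltBichar k n) (w : Set (Fin n)) (α β : Fin n →₀ ℕ) :
    Multiplicative (gammaPos w × gammaPos w) →* k where
  toFun m := (c (toInt m.toAdd.1) (toInt α) * c (toInt α) (toInt m.toAdd.2)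
    * (c (toInt m.toAdd.1) (toInt β) * c (toInt m.toAdd.2) (toInt β)) : kˣ)
  map_one' := by simp [toInt_zero, c.zero_left, c.zero_right]
  map_mul' m m' := by
    simp only [toAdd_mul, Prod.fst_add, Prod.snd_add, AddSubmonoid.coe_add, toInt_add,
      c.map_add_left, c.map_add_right, Units.val_mul]
    ring

/-- The pair character determines `c(α - β, -)` and `c(α + β, -)`, hence the squares of `c(α, -)`
and `c(β, -)`. The roots are unambiguous by `sq_cancel`. Multiplication on both sides is needed:
`x_γ` in the middle alone yields only the quotient. -/
theorem pairChar_eq_iff {q : Matrix (Fin n) (Fin n) kˣ} {c : AltBichar k n}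
    (hc : ∀ α β, c α β ^ 2 = sigma q α β) (hc_one : ∀ α β, sigma q α β = 1 → c α β = 1) {w : Set (Fin n)}
    {α β α' β' : Fin n →₀ ℕ} :
    pairChar c w α β = pairChar c w α' β' ↔
      charOf c w α = charOf c w α' ∧ charOf c w β = charOf c w β' := by
  constructor
  · intro h
    have h₁ : ∀ γ ∈ gammaPos w, c (toInt α) (toInt γ) / c (toInt β) (toInt γ)
        = c (toInt α') (toInt γ) / c (toInt β') (toInt γ) := fun γ hγ => by
      have := DFunLike.congr_fun h (Multiplicative.ofAdd (0, ⟨γ, hγ⟩))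
      simpa [pairChar, toInt_zero, c.zero_left, c.swap _ (toInt γ), ← Units.val_inv_eq_inv_val,
        ← Units.val_mul, Units.val_inj, div_eq_mul_inv, -Units.val_mul] using this
    have h₂ : ∀ γ ∈ gammaPos w, c (toInt α) (toInt γ) * c (toInt β) (toInt γ)
        = c (toInt α') (toInt γ) * c (toInt β') (toInt γ) := fun γ hγ => by
      have := DFunLike.congr_fun h (Multiplicative.ofAdd (⟨γ, hγ⟩, 0))
      simpa [pairChar, toInt_zero, c.zero_left, c.zero_right, c.swap _ (toInt γ),
        ← Units.val_inv_eq_inv_val, ← Units.val_mul, Units.val_inj, ← mul_inv,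
        -Units.val_mul, -mul_inv_rev] using this
    -- Equality of squares says `σ(δ - δ', γ) = 1`, whence `c(δ - δ', γ) = 1`; a sign ambiguity is
    -- thus excluded.
    have sq_cancel : ∀ {δ δ' γ : Fin n →₀ ℕ},
        c (toInt δ) (toInt γ) ^ 2 = c (toInt δ') (toInt γ) ^ 2 →
        c (toInt δ) (toInt γ) = c (toInt δ') (toInt γ) := fun {δ δ' γ} hsq => by
      rw [← div_eq_one, ← c.sub_left]
      apply hc_one
      rw [← hc, c.sub_left, div_pow, hsq, div_self']
    have hα : ∀ γ ∈ gammaPos w, c (toInt α) (toInt γ) = c (toInt α') (toInt γ) := fun γ hγ => by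
      apply sq_cancel
      have := congrArg₂ (· * ·) (h₁ γ hγ) (h₂ γ hγ)
      simpa only [div_mul_mul_cancel, sq] using this
    refine ⟨charOf_eq_iff.mpr hα, charOf_eq_iff.mpr fun γ hγ => ?_⟩
    have := h₂ γ hγ
    rwa [hα γ hγ, mul_right_inj] at this
  · rintro ⟨hα, hβ⟩
    rw [charOf_eq_iff] at hα hβ
    refine MonoidHom.ext fun m => ?_
    simp only [pairChar, MonoidHom.coe_mk, OneHom.coe_mk, Units.val_inj]
    rw [c.swap (toInt α), c.swap (toInt α'), c.swap (toInt β), c.swap (toInt β'),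
      c.swap (toInt β) (toInt m.toAdd.2), c.swap (toInt β') (toInt m.toAdd.2),
      hα _ m.toAdd.1.2, hα _ m.toAdd.2.2, hβ _ m.toAdd.1.2, hβ _ m.toAdd.2.2]

/-- The scalar is split into a factor in `(γ', γ)` alone, the value of `pairChar`, and `c(α, β)`, so
that separation of characters applies to the sum. -/
theorem twist_xBasis_mul_mul_xBasis_mul (a b : QSpace q) (γ' γ : Fin n →₀ ℕ) :
    twist hc (xBasis hc γ' * a * xBasis hc γ * b)
      = (c (toInt γ') (toInt γ) : k) • (monomial (γ' + γ) 1 *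
        ∑ p ∈ (twist hc a).support ×ˢ (twist hc b).support,
          ((c (toInt γ') (toInt p.1) * c (toInt p.1) (toInt γ)
            * (c (toInt γ') (toInt p.2) * c (toInt γ) (toInt p.2)) : kˣ) : k) •
          ((c (toInt p.1) (toInt p.2) : k) •
            (monomial p.1 (coeff p.1 (twist hc a)) * monomial p.2 (coeff p.2 (twist hc b))))) := by
  conv_lhs => rw [← sum_coeff_smul_xBasis hc a, ← sum_coeff_smul_xBasis hc b]
  rw [Finset.mul_sum _ _ (xBasis hc γ'), Finset.sum_mul, Finset.sum_mul_sum, ← Finset.sum_product', map_sum,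
    Finset.mul_sum, Finset.smul_sum]
  refine Finset.sum_congr rfl fun p _ => ?_
  simp only [mul_smul_comm, smul_mul_assoc, xBasis_mul_xBasis, map_smul, twist_xBasis,
    monomial_mul, smul_monomial, smul_eq_mul, toInt_add, c.map_add_left, Units.val_mul]
  rw [show γ' + p.1 + γ + p.2 = γ' + γ + (p.1 + p.2) by abel]
  congr 1
  ring

theorem forall_comp_mem_or_forall_comp_mem (hc_one : ∀ α β, sigma q α β = 1 → c α β = 1)
    {w : Set (Fin n)} {P : Ideal (MvPolynomial (Fin n) k)} [P.IsPrime]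
    (hP : ∀ i, X i ∈ P ↔ i ∈ w) {a b : QSpace q}
    (h : ∀ γ' γ, twist hc (xBasis hc γ' * a * xBasis hc γ * b) ∈ P) :
    (∀ χ, comp c w (twist hc a) χ ∈ P) ∨ ∀ χ, comp c w (twist hc b) χ ∈ P := by
  classical
  have hmon : ∀ {α}, α ∉ gammaPos w → ∀ r : k, monomial α r ∈ P :=
    monomial_mem_of_notMem_gammaPos fun i => (hP i).mpr
  have exists_rep : ∀ {f χ}, comp c w f χ ∉ P → ∃ α ∈ gammaPos w, charOf c w α = χ :=
    fun {f χ} hf => by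
      -- A component without exponents in `Γ_w` is a sum of monomials in `P`.
      by_contra! hα
      exact hf (sum_mem fun α hα' => hmon (fun hαw => hα α hαw (Finset.mem_filter.mp hα').2) _)
  by_contra! hab
  obtain ⟨⟨χ, hχ⟩, ψ, hψ⟩ := hab
  obtain ⟨α₀, hα₀, rfl⟩ := exists_rep hχ
  obtain ⟨β₀, hβ₀, rfl⟩ := exists_rep hψ
  have key := sum_fiber_mem_of_forall_char (P.restrictScalars k)
    ((twist hc a).support ×ˢ (twist hc b).support) (fun p => pairChar c w p.1 p.2)
    (fun p => (c (toInt p.1) (toInt p.2) : k) •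
      (monomial p.1 (coeff p.1 (twist hc a)) * monomial p.2 (coeff p.2 (twist hc b))))
    (fun m => by
      have hm := h m.toAdd.1 m.toAdd.2
      rw [twist_xBasis_mul_mul_xBasis_mul] at hm
      have hm' := Submodule.smul_of_tower_mem P
        ((c (toInt m.toAdd.1) (toInt m.toAdd.2))⁻¹ : kˣ).val hm
      rw [smul_smul, Units.inv_mul, one_smul] at hm'
      exact (Ideal.IsPrime.mem_or_mem ‹_› hm').resolve_left
        (monomial_notMem_of_mem_gammaPos (fun i => (hP i).mp)
          (add_mem m.toAdd.1.2 m.toAdd.2.2)))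
    (pairChar c w α₀ β₀)
  simp only [pairChar_eq_iff hc hc_one] at key
  rw [Finset.filter_product (fun α => charOf c w α = charOf c w α₀)
    (fun β => charOf c w β = charOf c w β₀), Submodule.restrictScalars_mem] at key
  have hmul : (c (toInt α₀) (toInt β₀) : k) •
      (comp c w (twist hc a) (charOf c w α₀) * comp c w (twist hc b) (charOf c w β₀)) ∈ P := by
    rw [comp, comp, Finset.sum_mul_sum, ← Finset.sum_product', Finset.smul_sum]
    -- On the fibre, `c(α, β) = c(α₀, β) = c(α₀, β₀)` for exponents in `Γ_w`. Replacing `c(α, β)` by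
    -- this constant therefore changes the sum only by elements of `P`, and the sum factors as a
    -- product of components.
    refine (Submodule.sub_mem_iff_left P key).mp ?_
    rw [← Finset.sum_sub_distrib]
    refine sum_mem fun p hp => ?_
    rw [Finset.mem_product, Finset.mem_filter, Finset.mem_filter] at hp
    rw [← sub_smul]
    by_cases h₁ : p.1 ∈ gammaPos w
    · by_cases h₂ : p.2 ∈ gammaPos w
      · rw [charOf_eq_iff.mp hp.1.2 _ h₂, c.swap (toInt p.2), charOf_eq_iff.mp hp.2.2 _ hα₀,
          ← c.swap, sub_self, zero_smul]
        exact P.zero_mem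
      · exact Submodule.smul_of_tower_mem P _ (P.mul_mem_left _ (hmon h₂ _))
    · exact Submodule.smul_of_tower_mem P _ (P.mul_mem_right _ (hmon h₁ _))
  have hmul' := Submodule.smul_of_tower_mem P ((c (toInt α₀) (toInt β₀))⁻¹ : kˣ).val hmul
  rw [smul_smul, Units.inv_mul, one_smul] at hmul'
  exact (Ideal.IsPrime.mem_or_mem ‹_› hmul').elim hχ hψ

theorem isPrimeTwoSided_twistedIdeal (hc_one : ∀ α β, sigma q α β = 1 → c α β = 1)
    {w : Set (Fin n)} {P : Ideal (MvPolynomial (Fin n) k)} [hPp : P.IsPrime]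
    (hP : ∀ i, X i ∈ P ↔ i ∈ w) :
    IsPrimeTwoSided (twistedIdeal hc hc_one w P fun i => (hP i).mpr) := by
  have hle := (isGreatest_twistedIdeal hc hc_one hP).1
  have mem_iff : ∀ {a}, a ∈ twistedIdeal hc hc_one w P (fun i => (hP i).mpr) ↔
      ∀ χ, comp c w (twist hc a) χ ∈ P := fun {a} => by
    rw [mem_twistedIdeal, mem_orbitInf_iff_comp hc hc_one fun i => (hP i).mpr]
  refine ⟨fun htop => hPp.ne_top ?_, fun J K hJK => ?_⟩
  · rw [Ideal.eq_top_iff_one]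
    have h : (twist hc).symm 1 ∈ twistedIdeal hc hc_one w P (fun i => (hP i).mpr) := by
      rw [htop]
      trivial
    simpa using hle h
  · by_contra! hcon
    obtain ⟨⟨a, haJ, ha⟩, b, hbK, hb⟩ := hcon.imp SetLike.not_le_iff_exists.mp
      SetLike.not_le_iff_exists.mp
    -- For `a ∈ J` and `b ∈ K`, also `x_γ' a x_γ ∈ J`, so its product with `b` lies in the ideal and
    -- hence in `Φ⁻¹(P)`.
    refine (forall_comp_mem_or_forall_comp_mem hc hc_one hP (a := a) (b := b)
      fun γ' γ => hle ?_).elim (fun h => ha (mem_iff.mpr h)) (fun h => hb (mem_iff.mpr h))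
    exact hJK _ (J.mul_mem_right _ _ (J.mul_mem_left _ _ haJ)) _ hbK

end

end

end QuantumAffine

open QuantumAffine in
theorem lemma3p6 {k : Type*} [Field k] [IsAlgClosed k] {n : ℕ}
    (q : Matrix (Fin n) (Fin n) kˣ) (hq : MulAntisymm q)
    (hneg : (-1 : kˣ) ∉ Subgroup.closure (Set.range fun p : Fin n × Fin n => q p.1 p.2) ∨
      CharP k 2)
    (c : AltBichar k n) (hc : ∀ α β, c α β ^ 2 = sigma q α β)
    (hc_one : ∀ α β, sigma q α β = 1 → c α β = 1) :
    ∃ φ : PrimeSpectrum (MvPolynomial (Fin n) k) → NCSpec (QSpace q),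
      (∀ (w : Set (Fin n)), ∀ P ∈ specStratum k w,
        ((φ P).1 : Set (QSpace q)) =
          twist hc ⁻¹' (orbitInf P.asIdeal (perp (radical q w)) :
            Set (MvPolynomial (Fin n) k))) ∧
      ∀ P : PrimeSpectrum (MvPolynomial (Fin n) k),
        IsGreatest
          {I : TwoSidedIdeal (QSpace q) |
            (I : Set (QSpace q)) ⊆ twist hc ⁻¹' (P.asIdeal : Set (MvPolynomial (Fin n) k))}
          (φ P).1 := by
  refine ⟨fun P => ⟨twistedIdeal hc hc_one {i | MvPolynomial.X i ∈ P.asIdeal} P.asIdeal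
    fun _ => id, isPrimeTwoSided_twistedIdeal hc hc_one fun _ => Iff.rfl⟩, fun w P hP => ?_,
    fun P => isGreatest_twistedIdeal hc hc_one fun _ => Iff.rfl⟩
  -- `P` lies in exactly one stratum, so the `w` used to define `φ` is the given one.
  obtain rfl : {i | MvPolynomial.X i ∈ P.asIdeal} = w := Set.ext hP
  exact Set.ext fun a => mem_twistedIdeal hc (hc_one := hc_one) (hP := fun _ => id)
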